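/- Let $G$ be a group, let $A$ and $B$ be nonempty sets and let $C\colon B\times A\to G$, $(b,a)\mapsto C_{ba}$, be a matrix. Let $S=\mathcal M(G,A,B,C)$ be the corresponding completely simple (Rees matrix) semigroup, that is, the set $A\times G\times B$ with the multiplication \[(a,g,b)(a',g',b')=(a,\,gC_{ba'}g',\,b'),\] and let $M=S^1$ be the monoid obtained from $S$ by adjoining an identity. A monoid $N$ is said to be of type $\mathrm{FP}_n$ if the trivial left $\mathbb ZN$-module $\mathbb Z$ (on which every element of $N$ acts as the identity) has a projective resolution $\cdots\to P_1\to P_0\to\mathbb Z\to 0$ by left $\mathbb ZN$-modules in which $P_0,\dots,P_n$ are finitely generated; this applies in particular to $N=G$. Suppose that $B$ is finite and let $n\geq 1$. Then $M$ is of type $\mathrm{FP}_n$ if and only if $A$ is finite and $G$ is of type $\mathrm{FP}_n$. -/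

import Mathlib

universe u v w

/-- The underlying set `A × G × B` of the Rees matrix semigroup `𝓜(G, A, B, C)`
with sandwich matrix `C : B × A → G`. -/
@[ext]
structure ReesMatrixSemigroup {G : Type u} {A : Type v} {B : Type w} (C : Matrix B A G) where
  fstIdx : A
  val : G
  sndIdx : B

namespace ReesMatrixSemigroup

variable {G : Type u} {A : Type v} {B : Type w} [Group G] (C : Matrix B A G)

/-- The multiplication `(a, g, b) (a', g', b') = (a, g C_{b a'} g', b')`. -/
instance : Mul (ReesMatrixSemigroup C) where
  mul x y := ⟨x.fstIdx, x.val * C x.sndIdx y.fstIdx * y.val, y.sndIdx⟩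

instance : Semigroup (ReesMatrixSemigroup C) where
  mul_assoc x y z := by
    change mk _ _ _ = mk _ _ _
    congr 1
    change x.val * C x.sndIdx y.fstIdx * y.val * C y.sndIdx z.fstIdx * z.val =
      x.val * C x.sndIdx y.fstIdx * (y.val * C y.sndIdx z.fstIdx * z.val)
    simp only [mul_assoc]

end ReesMatrixSemigroup

/-- A projective resolution `⋯ → X 2 → X 1 → X 0 → V → 0` of a left `R`-module `V`. -/
structure ModuleProjectiveResolution (R : Type u) [Ring R] (V : Type v) [AddCommGroup V]
    [Module R V] where
  X : ℕ → Type (max u v)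
  [addCommGroup : ∀ i, AddCommGroup (X i)]
  [module : ∀ i, Module R (X i)]
  /-- the differentials -/
  d : ∀ i, X (i + 1) →ₗ[R] X i
  /-- the augmentation -/
  ε : X 0 →ₗ[R] V
  projective : ∀ i, Module.Projective R (X i)
  surjective_ε : Function.Surjective ε
  exact_zero : Function.Exact (d 0) ε
  exact_succ : ∀ i, Function.Exact (d (i + 1)) (d i)

attribute [instance] ModuleProjectiveResolution.addCommGroup ModuleProjectiveResolution.module

/-- The left `R`-module `V` is of type `FP_n`: it has a projective resolution that is finitely
generated through degree `n`. -/
def ModuleIsOfTypeFP (R : Type u) [Ring R] (V : Type v) [AddCommGroup V] [Module R V]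
    (n : ℕ) : Prop :=
  ∃ P : ModuleProjectiveResolution R V, ∀ i ≤ n, Module.Finite R (P.X i)

/-- The monoid `M` is of type `FP_n`: the trivial left `ℤM`-module `ℤ` is of type `FP_n`. -/
def MonoidIsOfTypeFP (M : Type u) [Monoid M] (n : ℕ) : Prop :=
  ModuleIsOfTypeFP (MonoidAlgebra ℤ M) (Representation.trivial ℤ M ℤ).asModule n

open Function

set_option linter.unusedSectionVars false

universe z

/-! Fix `a₀`, `b₀` and put `e = (a₀, C_{b₀a₀}⁻¹, b₀)`, an idempotent with `eMe ≅ G`. Two functors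
compare modules over `ℤG` and `ℤM`. Induction `V ↦ ℤMe ⊗ V`, realised as `⨁_A V`, is left adjoint to
the corner functor `X ↦ eX`, which is in turn left adjoint to coinduction `V ↦ V^B`. All three
preserve surjections, so induction and the corner preserve projectives; both are exact. Induction
preserves finite generation, and so does the corner when `B` is finite, because `eM` meets `S` in a
free left `G`-set with orbits indexed by `B`. Hence both preserve type `FP_n`.

The corner of the trivial module is trivial, so `M` of type `FP_n` forces the same for `G`. For the
rest, induce the trivial `ℤG`-module to get `ℤA`, with augmentation `ℤA → ℤ`. Each `(a, g, b)` sends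
`x` to `aug(x)·a`, so `S` kills the augmentation kernel. If `ℤ` is finitely presented over `ℤM`,
this kernel is a finitely generated abelian group and `A` is finite. If `A` is finite, the kernel is
a finite power of `ℤ` with `S` acting by zero. That module is `ℤM/ℤS`, where `ℤS` is induced from
the free module `(ℤG)^B`; so it is of type `FP_n` for all `n`, and the augmentation sequence carries
finiteness from `ℤA` to `ℤ`. -/

/-- `V` is of type `FP_n`, by recursion on `n`: a module of type `FP_{n+1}` is the quotient of a
finitely generated projective module by a submodule of type `FP_n`. -/
def IsFP (R : Type u) [Ring R] : ℕ → ∀ (V : Type v) [AddCommGroup V] [Module R V], Prop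
  | 0, V, _, _ => Module.Finite R V
  | n + 1, V, _, _ => ∃ (P K : Type v) (_ : AddCommGroup P) (_ : AddCommGroup K) (_ : Module R P)
      (_ : Module R K) (i : K →ₗ[R] P) (p : P →ₗ[R] V), Module.Projective R P ∧
      Module.Finite R P ∧ Injective i ∧ Exact i p ∧ Surjective p ∧ IsFP R n K

/-! ### Closure properties of modules of type `FP_n` -/

namespace IsFP

variable {R : Type u} [Ring R] {n : ℕ}

theorem finite {V : Type v} [AddCommGroup V] [Module R V] (h : IsFP R n V) :
    Module.Finite R V := by
  cases n with
  | zero => exact h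
  | succ n =>
    obtain ⟨P, K, _, _, _, _, i, p, _, _, -, -, hp, -⟩ := h
    exact Module.Finite.of_surjective p hp

/-- Finite presentation gives a finitely generated kernel for every finitely generated cover, not
only for the projective one at hand; `finite_index` applies this to the augmentation. -/
theorem finitePresentation {V : Type v} [AddCommGroup V] [Module R V] (h : IsFP R (n + 1) V) :
    Module.FinitePresentation R V := by
  obtain ⟨P, K, _, _, _, _, i, p, _, _, -, hip, hp, hK⟩ := h
  have := Module.finitePresentation_of_projective R P
  refine Module.finitePresentation_of_surjective p hp ?_
  have := hK.finite
  rw [LinearMap.exact_iff.1 hip, LinearMap.range_eq_map]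
  exact Module.Finite.fg_top.map i

theorem of_linearEquiv {V : Type v} [AddCommGroup V] [Module R V] {V' : Type (max u w)}
    [AddCommGroup V'] [Module R V'] (e : V ≃ₗ[R] V') (h : IsFP R n V) : IsFP R n V' := by
  induction n generalizing V V' with
  | zero =>
    have : Module.Finite R V := h
    exact Module.Finite.equiv e
  | succ n ih =>
    obtain ⟨P, K, _, _, _, _, i, p, _, _, hi, hip, hp, hK⟩ := h
    -- Finitely generated modules are small relative to the ring, so the cover can be moved into the
    -- universe of `V'`.
    have : Small.{u} P := Module.Finite.small.{u} R P
    have : Small.{max u w} P := small_lift P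
    let s := Shrink.linearEquiv.{max u w} R P
    let q : Shrink.{max u w} P →ₗ[R] V' := e.toLinearMap ∘ₗ p ∘ₗ s.toLinearMap
    have hq : ∀ x, q x = 0 ↔ p (s x) = 0 := fun x => by simp [q]
    refine ⟨Shrink.{max u w} P, LinearMap.ker q, inferInstance, inferInstance, inferInstance,
      inferInstance, (LinearMap.ker q).subtype, q, inferInstance, inferInstance,
      Submodule.subtype_injective _, LinearMap.exact_subtype_ker_map q,
      e.surjective.comp (hp.comp s.surjective), ?_⟩
    refine ih (LinearEquiv.ofBijective (LinearMap.codRestrict (LinearMap.ker q)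
      (s.symm.toLinearMap ∘ₗ i) fun x => ?_) ⟨?_, ?_⟩) hK
    · simp [hq, hip.apply_apply_eq_zero]
    · rw [← LinearMap.ker_eq_bot, LinearMap.ker_codRestrict, LinearMap.ker_eq_bot]
      exact s.symm.injective.comp hi
    · rintro ⟨x, hx⟩
      obtain ⟨y, hy⟩ := (hip (s x)).1 ((hq x).1 hx)
      exact ⟨y, Subtype.ext (by simp [hy])⟩

/-- The class of modules of type `FP_n` is closed under extensions. -/
theorem extension {V₁ V V₂ : Type v} [AddCommGroup V₁] [Module R V₁] [AddCommGroup V] [Module R V]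
    [AddCommGroup V₂] [Module R V₂] (i : V₁ →ₗ[R] V) (p : V →ₗ[R] V₂) (hi : Injective i)
    (hip : Exact i p) (hp : Surjective p) (h₁ : IsFP R n V₁) (h₂ : IsFP R n V₂) : IsFP R n V := by
  induction n generalizing V₁ V V₂ with
  | zero =>
    have : Module.Finite R V₁ := h₁
    have : Module.Finite R V₂ := h₂
    have : Module.Finite R (LinearMap.range i) := inferInstance
    refine ⟨Submodule.fg_of_fg_map_of_fg_inf_ker p ?_ ?_⟩
    · rw [Submodule.map_top, LinearMap.range_eq_top.2 hp]
      exact Module.Finite.fg_top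
    · rw [top_inf_eq, LinearMap.exact_iff.1 hip, LinearMap.range_eq_map]
      exact Module.Finite.fg_top.map i
  | succ n ih =>
    obtain ⟨P₁, K₁, _, _, _, _, j₁, q₁, _, _, hj₁, hjq₁, hq₁, hK₁⟩ := h₁
    obtain ⟨P₂, K₂, _, _, _, _, j₂, q₂, _, _, hj₂, hjq₂, hq₂, hK₂⟩ := h₂
    -- Horseshoe construction: lifting `q₂` through `p` makes `P₁ × P₂` a cover of `V` whose kernel
    -- is an extension of `K₂` by `K₁`.
    obtain ⟨l, hl⟩ := Module.projective_lifting_property p q₂ hp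
    replace hl : ∀ x, p (l x) = q₂ x := fun x => LinearMap.congr_fun hl x
    let q : P₁ × P₂ →ₗ[R] V := LinearMap.coprod (i ∘ₗ q₁) l
    have hq : ∀ x, q x = i (q₁ x.1) + l x.2 := fun x => rfl
    have hpq : ∀ x, p (q x) = q₂ x.2 := fun x => by
      rw [hq, map_add, hip.apply_apply_eq_zero, zero_add, hl]
    have hK : ∀ x : LinearMap.ker q, ∃ y, j₂ y = x.1.2 := fun x =>
      (hjq₂ _).1 (by rw [← hpq, LinearMap.mem_ker.1 x.2, map_zero])
    let e₂ := LinearEquiv.ofInjective j₂ hj₂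
    let a : K₁ →ₗ[R] LinearMap.ker q :=
      LinearMap.codRestrict _ (LinearMap.inl R P₁ P₂ ∘ₗ j₁) fun x => by
        simp [hq, hjq₁.apply_apply_eq_zero]
    let b : LinearMap.ker q →ₗ[R] K₂ := e₂.symm.toLinearMap ∘ₗ
      LinearMap.codRestrict (LinearMap.range j₂)
        (LinearMap.snd R P₁ P₂ ∘ₗ (LinearMap.ker q).subtype) fun x => hK x
    have ha : ∀ x, (a x : P₁ × P₂) = (j₁ x, 0) := fun x => rfl
    have hb : ∀ x, j₂ (b x) = x.1.2 := fun x =>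
      congrArg Subtype.val (e₂.apply_symm_apply ⟨x.1.2, hK x⟩)
    refine ⟨P₁ × P₂, LinearMap.ker q, inferInstance, inferInstance, inferInstance, inferInstance,
      (LinearMap.ker q).subtype, q, inferInstance, inferInstance, Submodule.subtype_injective _,
      LinearMap.exact_subtype_ker_map q, ?_, ih a b ?_ ?_ ?_ hK₁ hK₂⟩
    · intro x
      obtain ⟨y, hy⟩ := hq₂ (p x)
      obtain ⟨z, hz⟩ := (hip (x - l y)).1 (by rw [map_sub, hl, hy, sub_self])
      obtain ⟨t, ht⟩ := hq₁ z
      exact ⟨(t, y), by simp [hq, ht, hz]⟩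
    · intro x y hxy
      exact hj₁ (congrArg (fun z : LinearMap.ker q => z.1.1) hxy)
    · intro x
      constructor
      · intro hx
        have h2 : x.1.2 = 0 := by rw [← hb, hx, map_zero]
        have h1 : q₁ x.1.1 = 0 := hi (by
          have := LinearMap.mem_ker.1 x.2
          rw [hq, h2, map_zero, add_zero] at this
          rw [this, map_zero])
        obtain ⟨y, hy⟩ := (hjq₁ _).1 h1
        exact ⟨y, Subtype.ext (Prod.ext hy h2.symm)⟩
      · rintro ⟨y, rfl⟩
        exact hj₂ (by rw [hb, ha, map_zero])
    · intro y
      obtain ⟨z, hz⟩ := (hip (l (j₂ y))).1 (by rw [hl, hjq₂.apply_apply_eq_zero])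
      obtain ⟨t, ht⟩ := hq₁ z
      refine ⟨⟨(-t, j₂ y), ?_⟩, hj₂ (hb _)⟩
      rw [LinearMap.mem_ker, hq, map_neg, map_neg, ht, hz, neg_add_cancel]

/-- A quotient of a module of type `FP_{n+1}` by a submodule of type `FP_n` is of type
`FP_{n+1}`. -/
theorem quotient {K E V : Type v} [AddCommGroup K] [Module R K] [AddCommGroup E] [Module R E]
    [AddCommGroup V] [Module R V] (i : K →ₗ[R] E) (p : E →ₗ[R] V) (hi : Injective i)
    (hip : Exact i p) (hp : Surjective p) (hK : IsFP R n K) (hE : IsFP R (n + 1) E) :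
    IsFP R (n + 1) V := by
  obtain ⟨P, K', _, _, _, _, j, q, _, _, hj, hjq, hq, hK'⟩ := hE
  let ei := LinearEquiv.ofInjective i hi
  -- The kernel of the composite `P → E → V` is an extension of `K` by `K'`, both of type `FP_n`.
  have h : ∀ x : LinearMap.ker (p ∘ₗ q), ∃ y, i y = q x := fun x => (hip _).1 x.2
  let a : K' →ₗ[R] LinearMap.ker (p ∘ₗ q) := LinearMap.codRestrict _ j fun x => by
    simp [hjq.apply_apply_eq_zero]
  let b : LinearMap.ker (p ∘ₗ q) →ₗ[R] K := ei.symm.toLinearMap ∘ₗ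
    LinearMap.codRestrict (LinearMap.range i) (q ∘ₗ (LinearMap.ker (p ∘ₗ q)).subtype) fun x => h x
  have hb : ∀ x, i (b x) = q x := fun x =>
    congrArg Subtype.val (ei.apply_symm_apply ⟨q x, h x⟩)
  refine ⟨P, LinearMap.ker (p ∘ₗ q), inferInstance, inferInstance, inferInstance, inferInstance,
    (LinearMap.ker (p ∘ₗ q)).subtype, p ∘ₗ q, inferInstance, inferInstance,
    Submodule.subtype_injective _, LinearMap.exact_subtype_ker_map _, hp.comp hq,
    extension a b ?_ ?_ ?_ hK' hK⟩
  · intro x y hxy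
    exact hj (congrArg Subtype.val hxy)
  · intro x
    constructor
    · intro hx
      obtain ⟨y, hy⟩ := (hjq _).1 (by rw [← hb, hx, map_zero])
      exact ⟨y, Subtype.ext hy⟩
    · rintro ⟨y, rfl⟩
      exact hi (by rw [hb, map_zero]; exact hjq.apply_apply_eq_zero y)
  · intro y
    obtain ⟨x, hx⟩ := hq (i y)
    exact ⟨⟨x, by simp [hx, hip.apply_apply_eq_zero]⟩, hi ((hb _).trans hx)⟩

theorem of_subsingleton (V : Type v) [AddCommGroup V] [Module R V] [Subsingleton V] :
    IsFP R n V := by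
  induction n with
  | zero => exact (inferInstance : Module.Finite R V)
  | succ n ih =>
    exact ⟨V, V, inferInstance, inferInstance, inferInstance, inferInstance, LinearMap.id,
      LinearMap.id, inferInstance, inferInstance, injective_id,
      fun x => ⟨fun _ => ⟨x, rfl⟩, fun _ => Subsingleton.elim _ _⟩, surjective_id, ih⟩

/-- Finite powers of a module of type `FP_n` are of type `FP_n`. -/
theorem pi_fin {V : Type v} [AddCommGroup V] [Module R V] (h : IsFP R n V) (k : ℕ) :
    IsFP R n (Fin k → V) := by
  induction k with
  | zero => exact of_subsingleton _
  | succ k ih =>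
    refine extension (LinearMap.single R (fun _ : Fin (k + 1) => V) 0)
      (LinearMap.funLeft R V Fin.succ) (Pi.single_injective (M := fun _ : Fin (k + 1) => V) 0) ?_
      (LinearMap.funLeft_surjective_of_injective _ _ _ (Fin.succ_injective k)) h ih
    intro x
    constructor
    · intro hx
      refine ⟨x 0, funext fun j => ?_⟩
      refine Fin.cases ?_ (fun j => ?_) j
      · simp
      · simpa using (congrFun hx j).symm
    · rintro ⟨y, rfl⟩
      ext j
      simp [LinearMap.funLeft_apply]

end IsFP

/-! ### Projective resolutions and the recursive definition -/

namespace ModuleProjectiveResolution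

/-- Splicing a resolution of the kernel `K` of `p : P → V` with `p`. -/
def splice {R : Type u} [Ring R] {V P : Type u} {K : Type u} [AddCommGroup V] [Module R V]
    [AddCommGroup P] [Module R P] [AddCommGroup K] [Module R K] [Module.Projective R P]
    (i : K →ₗ[R] P) (p : P →ₗ[R] V) (hi : Injective i) (hip : Exact i p) (hp : Surjective p)
    (Q : ModuleProjectiveResolution R K) : ModuleProjectiveResolution R V where
  X
    | 0 => P
    | j + 1 => Q.X j
  addCommGroup
    | 0 => inferInstance
    | _ + 1 => inferInstance
  module
    | 0 => inferInstance
    | _ + 1 => inferInstance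
  d
    | 0 => i ∘ₗ Q.ε
    | j + 1 => Q.d j
  ε := p
  projective
    | 0 => inferInstance
    | j + 1 => Q.projective j
  surjective_ε := hp
  exact_zero := Q.surjective_ε.comp_exact_iff_exact.2 hip
  exact_succ
    | 0 => hi.comp_exact_iff_exact.2 Q.exact_zero
    | j + 1 => Q.exact_succ j

/-- The part of a resolution in positive degrees resolves the kernel of the augmentation. -/
def shift {R : Type u} [Ring R] {V : Type u} [AddCommGroup V] [Module R V]
    (Q : ModuleProjectiveResolution R V) :
    ModuleProjectiveResolution R (LinearMap.ker Q.ε) where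
  X j := Q.X (j + 1)
  d j := Q.d (j + 1)
  ε := LinearMap.codRestrict _ (Q.d 0) fun x => Q.exact_zero.apply_apply_eq_zero x
  projective j := Q.projective (j + 1)
  surjective_ε := by
    rintro ⟨x, hx⟩
    obtain ⟨y, hy⟩ := (Q.exact_zero x).1 hx
    exact ⟨y, Subtype.ext hy⟩
  exact_zero x := by
    rw [← Q.exact_succ 0 x, ← Subtype.val_inj]
    rfl
  exact_succ j := Q.exact_succ (j + 1)

/-- The iterated kernels of the canonical free covers. -/
noncomputable def syzygy (R : Type u) [Ring R] (V : ModuleCat.{u} R) : ℕ → ModuleCat.{u} R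
  | 0 => V
  | j + 1 => ModuleCat.of R (LinearMap.ker
      (Finsupp.linearCombination R (id : syzygy R V j → syzygy R V j)))

/-- The canonical free resolution. -/
noncomputable def freeResolution (R : Type u) [Ring R] (V : Type u) [AddCommGroup V] [Module R V] :
    ModuleProjectiveResolution R V where
  X j := syzygy R (ModuleCat.of R V) j →₀ R
  d j := (LinearMap.ker (Finsupp.linearCombination R
      (id : syzygy R (ModuleCat.of R V) j → syzygy R (ModuleCat.of R V) j))).subtype ∘ₗ
    Finsupp.linearCombination R
      (id : syzygy R (ModuleCat.of R V) (j + 1) → syzygy R (ModuleCat.of R V) (j + 1))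
  ε := Finsupp.linearCombination R (id : V → V)
  projective _ := inferInstance
  surjective_ε := Finsupp.linearCombination_id_surjective R V
  exact_zero := (Finsupp.linearCombination_id_surjective R
    (syzygy R (ModuleCat.of R V) 1)).comp_exact_iff_exact.2
      (LinearMap.exact_subtype_ker_map (Finsupp.linearCombination R (id : V → V)))
  exact_succ j := (Submodule.subtype_injective _).comp_exact_iff_exact.2 <|
    (Finsupp.linearCombination_id_surjective R
      (syzygy R (ModuleCat.of R V) (j + 2))).comp_exact_iff_exact.2
        (LinearMap.exact_subtype_ker_map (Finsupp.linearCombination R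
          (id : syzygy R (ModuleCat.of R V) (j + 1) → syzygy R (ModuleCat.of R V) (j + 1))))

/-- Transport of a resolution along an isomorphism. -/
def congr {R : Type u} [Ring R] {V : Type v} {V' : Type (max u v)} [AddCommGroup V] [Module R V]
    [AddCommGroup V'] [Module R V'] (e : V ≃ₗ[R] V') (Q : ModuleProjectiveResolution R V) :
    ModuleProjectiveResolution R V' where
  X := Q.X
  d := Q.d
  ε := e.toLinearMap ∘ₗ Q.ε
  projective := Q.projective
  surjective_ε := e.surjective.comp Q.surjective_ε
  exact_zero := e.injective.comp_exact_iff_exact.2 Q.exact_zero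
  exact_succ := Q.exact_succ

/-- Transport of a resolution along an isomorphism. -/
def congrSymm {R : Type u} [Ring R] {V : Type v} {V' : Type (max u v)} [AddCommGroup V]
    [Module R V] [AddCommGroup V'] [Module R V'] (e : V' ≃ₗ[R] V)
    (Q : ModuleProjectiveResolution R V') : ModuleProjectiveResolution R V where
  X := Q.X
  d := Q.d
  ε := e.toLinearMap ∘ₗ Q.ε
  projective := Q.projective
  surjective_ε := e.surjective.comp Q.surjective_ε
  exact_zero := e.injective.comp_exact_iff_exact.2 Q.exact_zero
  exact_succ := Q.exact_succ

end ModuleProjectiveResolution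

theorem moduleIsOfTypeFP_iff_isFP {R : Type u} [Ring R] {n : ℕ} {V : Type u} [AddCommGroup V]
    [Module R V] : ModuleIsOfTypeFP R V n ↔ IsFP R n V := by
  constructor
  · rintro ⟨Q, hQ⟩
    induction n generalizing V with
    | zero =>
      have := hQ 0 le_rfl
      exact Module.Finite.of_surjective Q.ε Q.surjective_ε
    | succ n ih =>
      exact ⟨Q.X 0, LinearMap.ker Q.ε, inferInstance, inferInstance, inferInstance, inferInstance,
        (LinearMap.ker Q.ε).subtype, Q.ε, Q.projective 0, hQ 0 (Nat.zero_le _),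
        Submodule.subtype_injective _, LinearMap.exact_subtype_ker_map _, Q.surjective_ε,
        ih Q.shift fun j hj => hQ (j + 1) (Nat.succ_le_succ hj)⟩
  · intro h
    induction n generalizing V with
    | zero =>
      have : Module.Finite R V := h
      obtain ⟨k, f, hf⟩ := Module.Finite.exists_fin' R V
      -- Only degree `0` has to be finitely generated, so the kernel may be resolved by arbitrarily
      -- large free modules.
      refine ⟨.splice (LinearMap.ker f).subtype f (Submodule.subtype_injective _)
        (LinearMap.exact_subtype_ker_map _) hf (.freeResolution R _), fun j hj => ?_⟩
      obtain rfl := Nat.le_zero.1 hj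
      exact (inferInstance : Module.Finite R (Fin k → R))
    | succ n ih =>
      obtain ⟨P, K, _, _, _, _, i, p, _, hP, hi, hip, hp, hK⟩ := h
      obtain ⟨Q, hQ⟩ := ih hK
      refine ⟨.splice i p hi hip hp Q, fun j hj => ?_⟩
      cases j with
      | zero => exact hP
      | succ j => exact hQ j (Nat.le_of_succ_le_succ hj)

/-- The terms of the resolutions of `V` and of `V'` live in the same universe, so only the
augmentation changes. This moves `ℤ` out of `Type` into the universe of the ring. -/
theorem moduleIsOfTypeFP_iff_of_linearEquiv {R : Type u} [Ring R] {n : ℕ} {V : Type v}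
    {V' : Type (max u v)} [AddCommGroup V] [Module R V] [AddCommGroup V'] [Module R V']
    (e : V ≃ₗ[R] V') : ModuleIsOfTypeFP R V n ↔ ModuleIsOfTypeFP R V' n :=
  ⟨fun ⟨Q, hQ⟩ => ⟨Q.congr e, hQ⟩, fun ⟨Q, hQ⟩ => ⟨Q.congrSymm e.symm, hQ⟩⟩

/-! ### Modules over integral monoid rings -/

namespace MonoidAlgebra

/-- An additive map commuting with the action of the monoid is linear over the monoid ring. -/
def linearOfEquivariant {M : Type u} [Monoid M] {V : Type v} {W : Type w} [AddCommGroup V]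
    [AddCommGroup W] [Module (MonoidAlgebra ℤ M) V] [Module (MonoidAlgebra ℤ M) W] (f : V →+ W)
    (h : ∀ m v, f (of ℤ M m • v) = of ℤ M m • f v) : V →ₗ[MonoidAlgebra ℤ M] W where
  __ := f
  map_smul' r v := by
    change f (r • v) = r • f v
    induction r using MonoidAlgebra.induction_on with
    | of m => exact h m v
    | add x y hx hy => rw [add_smul, add_smul, map_add, hx, hy]
    | smul z x hx => rw [smul_assoc, smul_assoc, map_zsmul, hx]

theorem map_mem_of_forall_of {M : Type u} [Monoid M] {X : Type v} [AddCommGroup X]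
    (N : AddSubgroup X) (f : MonoidAlgebra ℤ M →+ X) (h : ∀ m, f (of ℤ M m) ∈ N)
    (r : MonoidAlgebra ℤ M) : f r ∈ N := by
  induction r using MonoidAlgebra.induction_on with
  | of m => exact h m
  | add x y hx hy => rw [map_add]; exact N.add_mem hx hy
  | smul z x hx => rw [map_zsmul]; exact N.zsmul_mem hx z

/-- The module over the integral monoid ring defined by an action on an abelian group. -/
noncomputable abbrev moduleOfAction {M : Type u} [Monoid M] (X : Type v) [AddCommGroup X]
    (ρ : M →* AddMonoid.End X) : Module (MonoidAlgebra ℤ M) X :=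
  Module.compHom X (lift ℤ (AddMonoid.End X) M ρ).toRingHom

theorem moduleOfAction_of_smul {M : Type u} [Monoid M] {X : Type v} [AddCommGroup X]
    (ρ : M →* AddMonoid.End X) (m : M) (x : X) :
    (letI := moduleOfAction X ρ; of ℤ M m • x) = ρ m x := by
  change lift ℤ (AddMonoid.End X) M ρ (of ℤ M m) x = ρ m x
  rw [lift_of]

end MonoidAlgebra

/-! ### The monoid ring of `S¹` and its modules -/

namespace ReesMatrixSemigroup

open MonoidAlgebra

section

variable {G : Type u} {A : Type v} {B : Type w} [Group G] (C : Matrix B A G)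

/-- The integral monoid ring of the monoid obtained from the Rees matrix semigroup by adjoining
an identity. -/
abbrev MonoidRing : Type (max u v w) := MonoidAlgebra ℤ (WithOne (ReesMatrixSemigroup C))

/-- The element `(a, g, b)` of the monoid ring. -/
noncomputable def elt (a : A) (g : G) (b : B) : MonoidRing C :=
  of ℤ (WithOne (ReesMatrixSemigroup C)) ((⟨a, g, b⟩ : ReesMatrixSemigroup C) : WithOne _)

theorem elt_mul_elt (a a' : A) (g g' : G) (b b' : B) :
    elt C a g b * elt C a' g' b' = elt C a (g * C b a' * g') b' := by
  rw [elt, elt, ← map_mul, ← WithOne.coe_mul]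
  rfl

theorem elt_smul_elt_smul {V : Type*} [AddCommGroup V] [Module (MonoidRing C) V] (a a' : A)
    (g g' : G) (b b' : B) (v : V) :
    elt C a g b • elt C a' g' b' • v = elt C a (g * C b a' * g') b' • v := by
  rw [smul_smul, elt_mul_elt]

/-- An additive map commuting with the action of the semigroup is linear over the monoid ring. -/
noncomputable def linearOfElt {V W : Type*} [AddCommGroup V] [AddCommGroup W]
    [Module (MonoidRing C) V] [Module (MonoidRing C) W] (f : V →+ W)
    (h : ∀ a g b v, f (elt C a g b • v) = elt C a g b • f v) : V →ₗ[MonoidRing C] W :=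
  linearOfEquivariant f fun m v => by
    refine WithOne.cases_on (P := fun m => f (of ℤ _ m • v) = of ℤ _ m • f v) m ?_ fun s => ?_
    · simp only [map_one, one_smul]
    · exact h s.1 s.2 s.3 v

theorem map_mem_of_forall_elt {X : Type*} [AddCommGroup X] (N : AddSubgroup X)
    (f : MonoidRing C →+ X) (h1 : f 1 ∈ N) (h : ∀ a g b, f (elt C a g b) ∈ N)
    (r : MonoidRing C) : f r ∈ N :=
  map_mem_of_forall_of N f (fun m => by
    refine WithOne.cases_on (P := fun m => f (of ℤ _ m) ∈ N) m ?_ fun s => ?_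
    · rwa [map_one]
    · exact h s.1 s.2 s.3) r

variable {C} in
/-- The module over the monoid ring defined by an action of the semigroup. -/
noncomputable abbrev moduleOfSemigroupAction (X : Type*) [AddCommGroup X]
    (ρ : A → G → B → AddMonoid.End X)
    (h : ∀ a g b a' g' b', ρ a (g * C b a' * g') b' = ρ a g b * ρ a' g' b') :
    Module (MonoidRing C) X :=
  moduleOfAction X (WithOne.lift ⟨fun s => ρ s.1 s.2 s.3, fun _ _ => h _ _ _ _ _ _⟩)

theorem moduleOfSemigroupAction_elt_smul {X : Type*} [AddCommGroup X]
    (ρ : A → G → B → AddMonoid.End X)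
    (h : ∀ a g b a' g' b', ρ a (g * C b a' * g') b' = ρ a g b * ρ a' g' b')
    (a : A) (g : G) (b : B) (x : X) :
    (letI := moduleOfSemigroupAction (C := C) X ρ h; elt C a g b • x) = ρ a g b x :=
  moduleOfAction_of_smul _ _ _

/-! ### Induction from the group to the monoid -/

/-- The module over the monoid ring induced from the module `V` over the group ring. -/
def Induced (_ : Matrix B A G) (V : Type*) [Zero V] := A →₀ V

namespace Induced

variable (V : Type*) [AddCommGroup V] [Module (MonoidAlgebra ℤ G) V]

noncomputable instance : AddCommGroup (Induced C V) := inferInstanceAs (AddCommGroup (A →₀ V))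

variable {V}

/-- The inclusion of the summand with index `a`. -/
noncomputable def ι (a : A) : V →+ Induced C V := Finsupp.singleAddHom a

/-- The universal property of the induced module, as a direct sum. -/
noncomputable def lift {X : Type*} [AddCommGroup X] (f : A → V →+ X) : Induced C V →+ X :=
  Finsupp.liftAddHom f

@[simp]
theorem lift_ι {X : Type*} [AddCommGroup X] (f : A → V →+ X) (a : A) (v : V) :
    lift C f (ι C a v) = f a v := Finsupp.liftAddHom_apply_single _ _ _

theorem hom_ext {X : Type*} [AddCommGroup X] {f g : Induced C V →+ X}
    (h : ∀ a v, f (ι C a v) = g (ι C a v)) : f = g := Finsupp.addHom_ext h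

theorem induction {N : AddSubgroup (Induced C V)} (h : ∀ a v, ι C a v ∈ N) (x : Induced C V) :
    x ∈ N := by
  induction x using Finsupp.induction_linear with
  | zero => exact N.zero_mem
  | add x y hx hy => exact N.add_mem hx hy
  | single a v => exact h a v

/-- The action of the semigroup on the induced module. -/
noncomputable def action (a : A) (g : G) (b : B) : AddMonoid.End (Induced C V) :=
  (ι C a).comp (lift C fun a' => DistribSMul.toAddMonoidHom V (of ℤ G (g * C b a')))

theorem action_ι (a a' : A) (g : G) (b : B) (v : V) :
    action C a g b (ι C a' v) = ι C a (of ℤ G (g * C b a') • v) := by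
  change ι C a (lift C _ _) = _
  rw [lift_ι]
  rfl

theorem action_mul (a : A) (g : G) (b : B) (a' : A) (g' : G) (b' : B) :
    (action C a (g * C b a' * g') b' : AddMonoid.End (Induced C V)) =
      action C a g b * action C a' g' b' := by
  refine hom_ext C fun a'' v => ?_
  refine (action_ι C a a'' _ b' v).trans ?_
  refine Eq.trans ?_ (congrArg (action C a g b) (action_ι C a' a'' g' b' v)).symm
  rw [action_ι, smul_smul, ← map_mul]
  simp only [mul_assoc]

noncomputable instance : Module (MonoidRing C) (Induced C V) :=
  moduleOfSemigroupAction _ (action C) (action_mul C)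

theorem elt_smul (a : A) (g : G) (b : B) (x : Induced C V) :
    elt C a g b • x = action C a g b x :=
  moduleOfSemigroupAction_elt_smul C (action C) (action_mul C) a g b x

theorem elt_smul_ι (a a' : A) (g : G) (b : B) (v : V) :
    elt C a g b • ι C a' v = ι C a (of ℤ G (g * C b a') • v) := by
  rw [elt_smul, action_ι]

/-- Linear maps out of an induced module. -/
noncomputable def linearLift {X : Type*} [AddCommGroup X] [Module (MonoidRing C) X]
    (f : A → V →+ X)
    (h : ∀ a g b a' v, f a (of ℤ G (g * C b a') • v) = elt C a g b • f a' v) :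
    Induced C V →ₗ[MonoidRing C] X :=
  linearOfElt C (lift C f) fun a g b x => by
    refine DFunLike.congr_fun (f := (lift C f).comp (DistribSMul.toAddMonoidHom _ (elt C a g b)))
      (g := (DistribSMul.toAddMonoidHom _ (elt C a g b)).comp (lift C f)) (hom_ext C ?_) x
    intro a' v
    simp only [AddMonoidHom.comp_apply, DistribSMul.toAddMonoidHom_apply, elt_smul_ι, lift_ι, h]

@[simp]
theorem linearLift_ι {X : Type*} [AddCommGroup X] [Module (MonoidRing C) X] (f : A → V →+ X)
    (h : ∀ a g b a' v, f a (of ℤ G (g * C b a') • v) = elt C a g b • f a' v) (a : A) (v : V) :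
    linearLift C f h (ι C a v) = f a v := lift_ι C f a v

theorem linearMap_ext {X : Type*} [AddCommGroup X] [Module (MonoidRing C) X]
    {f g : Induced C V →ₗ[MonoidRing C] X} (h : ∀ a v, f (ι C a v) = g (ι C a v)) : f = g :=
  LinearMap.toAddMonoidHom_injective (hom_ext C h)

variable {W : Type*} [AddCommGroup W] [Module (MonoidAlgebra ℤ G) W]

/-- Functoriality of the induced module. -/
noncomputable def map (f : V →ₗ[MonoidAlgebra ℤ G] W) :
    Induced C V →ₗ[MonoidRing C] Induced C W :=
  linearLift C (fun a => (ι C a).comp f.toAddMonoidHom) fun a g b a' v => by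
    simp [elt_smul_ι]

@[simp]
theorem map_ι (f : V →ₗ[MonoidAlgebra ℤ G] W) (a : A) (v : V) :
    map C f (ι C a v) = ι C a (f v) := linearLift_ι C _ _ a v

theorem map_eq_mapRange (f : V →ₗ[MonoidAlgebra ℤ G] W) (x : Induced C V) :
    map C f x = Finsupp.mapRange.linearMap f (show A →₀ V from x) := by
  refine DFunLike.congr_fun (f := (map C f).toAddMonoidHom)
    (g := (Finsupp.mapRange.linearMap (α := A) f).toAddMonoidHom) (hom_ext C ?_) x
  intro a v
  refine (map_ι C f a v).trans ?_
  exact (Finsupp.mapRange_single (f := f) (hf := map_zero f)).symm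

theorem map_injective {f : V →ₗ[MonoidAlgebra ℤ G] W} (hf : Injective f) :
    Injective (map C f) := by
  intro x y h
  rw [map_eq_mapRange, map_eq_mapRange] at h
  exact Finsupp.mapRange_injective f (map_zero f) hf h

theorem map_surjective {f : V →ₗ[MonoidAlgebra ℤ G] W} (hf : Surjective f) :
    Surjective (map C f) := by
  intro y
  obtain ⟨x, hx⟩ := Finsupp.mapRange_surjective (α := A) f (map_zero f) hf y
  exact ⟨x, (map_eq_mapRange C f x).trans hx⟩

theorem map_exact {U : Type*} [AddCommGroup U] [Module (MonoidAlgebra ℤ G) U]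
    {i : U →ₗ[MonoidAlgebra ℤ G] V} {p : V →ₗ[MonoidAlgebra ℤ G] W} (h : Exact i p) :
    Exact (map C i) (map C p) := by
  intro x
  constructor
  · intro hx
    rw [map_eq_mapRange] at hx
    have hx' : (show A →₀ V from x) ∈ Set.range (Finsupp.mapRange i (map_zero i)) := by
      rw [Finsupp.range_mapRange]
      exact fun a => (h _).1 (DFunLike.congr_fun (F := A →₀ W) hx a)
    obtain ⟨y, hy⟩ := hx'
    exact ⟨y, (map_eq_mapRange C i y).trans hy⟩
  · rintro ⟨y, rfl⟩
    refine LinearMap.congr_fun (f := map C p ∘ₗ map C i) (g := 0) (linearMap_ext C ?_) y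
    intro a v
    simp [h.apply_apply_eq_zero]

/-- Generators of `V` placed in the summand `a₀` suffice: `(a₀, g C_{b₀a₀}⁻¹, b₀)` acts on that
summand as `g`, and `(a, C_{b₀a₀}⁻¹, b₀)` carries it identically onto the summand `a`. -/
theorem finite [Nonempty A] [Nonempty B] [Module.Finite (MonoidAlgebra ℤ G) V] :
    Module.Finite (MonoidRing C) (Induced C V) := by
  obtain ⟨a₀⟩ := ‹Nonempty A›
  obtain ⟨b₀⟩ := ‹Nonempty B›
  obtain ⟨t, ht⟩ := Module.Finite.fg_top (R := MonoidAlgebra ℤ G) (M := V)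
  classical
  refine ⟨⟨t.image (ι C a₀), eq_top_iff.2 fun x _ => ?_⟩⟩
  set N := Submodule.span (MonoidRing C) (t.image (ι C a₀) : Set (Induced C V))
  have h : ∀ v, ι C a₀ v ∈ N := fun v => by
    have hv : v ∈ Submodule.span (MonoidAlgebra ℤ G) (t : Set V) := ht ▸ Submodule.mem_top
    induction hv using Submodule.span_induction with
    | mem v hv => exact Submodule.subset_span (Finset.mem_coe.2 (Finset.mem_image_of_mem _ hv))
    | zero => rw [map_zero]; exact N.zero_mem
    | add v w _ _ hv hw => rw [map_add]; exact N.add_mem hv hw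
    | smul r v _ hv =>
      refine map_mem_of_forall_of N.toAddSubgroup
        ((ι C a₀).comp ((LinearMap.toSpanSingleton (MonoidAlgebra ℤ G) V v).toAddMonoidHom))
        (fun g => ?_) r
      have := N.smul_mem (elt C a₀ (g * (C b₀ a₀)⁻¹) b₀) hv
      rwa [elt_smul_ι, inv_mul_cancel_right] at this
  refine induction C (N := N.toAddSubgroup) (fun a v => ?_) x
  have := N.smul_mem (elt C a (C b₀ a₀)⁻¹ b₀) (h v)
  rwa [elt_smul_ι, inv_mul_cancel, map_one, one_smul] at this

end Induced

/-! ### Coinduction from the group to the monoid -/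

/-- The module over the monoid ring coinduced from the module `V` over the group ring. -/
def Coinduced (_ : Matrix B A G) (V : Type*) := B → V

namespace Coinduced

variable (V : Type*) [AddCommGroup V] [Module (MonoidAlgebra ℤ G) V]

instance : AddCommGroup (Coinduced C V) := inferInstanceAs (AddCommGroup (B → V))

variable {V}

/-- The action of the semigroup on the coinduced module. -/
noncomputable def action (a : A) (g : G) (b : B) : AddMonoid.End (Coinduced C V) where
  toFun f b' := of ℤ G (C b' a * g) • f b
  map_zero' := funext fun _ => smul_zero _
  map_add' _ _ := funext fun _ => smul_add _ _ _

theorem action_mul (a : A) (g : G) (b : B) (a' : A) (g' : G) (b' : B) :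
    (action C a (g * C b a' * g') b' : AddMonoid.End (Coinduced C V)) =
      action C a g b * action C a' g' b' := by
  refine AddMonoidHom.ext fun f => funext fun b'' => ?_
  change of ℤ G _ • f b' = of ℤ G _ • of ℤ G _ • f b'
  rw [smul_smul, ← map_mul]
  simp only [mul_assoc]

noncomputable instance : Module (MonoidRing C) (Coinduced C V) :=
  moduleOfSemigroupAction _ (action C) (action_mul C)

theorem elt_smul_apply (a : A) (g : G) (b b' : B) (f : Coinduced C V) :
    (elt C a g b • f) b' = of ℤ G (C b' a * g) • f b :=
  congrFun (moduleOfSemigroupAction_elt_smul C (action C) (action_mul C) a g b f) b'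

variable {W : Type*} [AddCommGroup W] [Module (MonoidAlgebra ℤ G) W]

/-- Functoriality of the coinduced module. -/
noncomputable def map (f : V →ₗ[MonoidAlgebra ℤ G] W) :
    Coinduced C V →ₗ[MonoidRing C] Coinduced C W :=
  linearOfElt C
    { toFun := fun x b => f (x b)
      map_zero' := funext fun _ => map_zero f
      map_add' := fun _ _ => funext fun _ => map_add f _ _ } fun a g b x => funext fun b' => by
    change f ((elt C a g b • x) b') = _
    rw [elt_smul_apply, elt_smul_apply, map_smul]
    rfl

theorem map_surjective {f : V →ₗ[MonoidAlgebra ℤ G] W} (hf : Surjective f) :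
    Surjective (map C f) :=
  fun y => ⟨fun b => (hf (y b)).choose, funext fun b => (hf (y b)).choose_spec⟩

end Coinduced

/-! ### Restriction to the maximal subgroup -/

/-- The image of the idempotent `(a₀, (C b₀ a₀)⁻¹, b₀)` on the module `V`. -/
def Corner (a₀ : A) (b₀ : B) (V : Type z) [AddCommGroup V] [Module (MonoidRing C) V] : Type z :=
  ↥(AddMonoidHom.eqLocus (DistribSMul.toAddMonoidHom V (elt C a₀ (C b₀ a₀)⁻¹ b₀))
    (AddMonoidHom.id V) : AddSubgroup V)

namespace Corner

variable (a₀ : A) (b₀ : B) {V W : Type*} [AddCommGroup V] [Module (MonoidRing C) V]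
  [AddCommGroup W] [Module (MonoidRing C) W]

noncomputable instance : AddCommGroup (Corner C a₀ b₀ V) := inferInstanceAs (AddCommGroup
  (AddMonoidHom.eqLocus (DistribSMul.toAddMonoidHom V (elt C a₀ (C b₀ a₀)⁻¹ b₀))
    (AddMonoidHom.id V) : AddSubgroup V))

/-- The inclusion of the corner. -/
noncomputable def val : Corner C a₀ b₀ V →+ V := AddSubgroup.subtype _

theorem val_injective : Injective (val C a₀ b₀ : Corner C a₀ b₀ V →+ V) := Subtype.val_injective

theorem elt_smul_val (x : Corner C a₀ b₀ V) :
    elt C a₀ (C b₀ a₀)⁻¹ b₀ • val C a₀ b₀ x = val C a₀ b₀ x := x.2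

/-- An additive map whose values are fixed by the idempotent, as a map to the corner. -/
noncomputable def codRestrict {X : Type*} [AddCommGroup X] (f : X →+ V)
    (h : ∀ x, elt C a₀ (C b₀ a₀)⁻¹ b₀ • f x = f x) : X →+ Corner C a₀ b₀ V :=
  AddMonoidHom.codRestrict f _ h

/-- Left multiplication by `(a₀, g, b)`, as a map to the corner. -/
noncomputable def mulElt (g : G) (b : B) : V →+ Corner C a₀ b₀ V :=
  codRestrict C a₀ b₀ (DistribSMul.toAddMonoidHom V (elt C a₀ g b)) fun x => by
    rw [DistribSMul.toAddMonoidHom_apply, elt_smul_elt_smul, inv_mul_cancel, one_mul]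

theorem val_mulElt (g : G) (b : B) (x : V) :
    val C a₀ b₀ (mulElt C a₀ b₀ g b x) = elt C a₀ g b • x := rfl

/-- The action of the group on the corner. -/
noncomputable def action : G →* AddMonoid.End (Corner C a₀ b₀ V) where
  toFun g := (mulElt C a₀ b₀ (g * (C b₀ a₀)⁻¹) b₀).comp (val C a₀ b₀)
  map_one' := AddMonoidHom.ext fun x => val_injective C a₀ b₀ <| by
    change elt C a₀ (1 * (C b₀ a₀)⁻¹) b₀ • val C a₀ b₀ x = val C a₀ b₀ x
    rw [one_mul, elt_smul_val]
  map_mul' g h := AddMonoidHom.ext fun x => val_injective C a₀ b₀ <| by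
    change elt C a₀ (g * h * (C b₀ a₀)⁻¹) b₀ • val C a₀ b₀ x =
      elt C a₀ (g * (C b₀ a₀)⁻¹) b₀ • elt C a₀ (h * (C b₀ a₀)⁻¹) b₀ • val C a₀ b₀ x
    rw [elt_smul_elt_smul, inv_mul_cancel_right, mul_assoc]

noncomputable instance : Module (MonoidAlgebra ℤ G) (Corner C a₀ b₀ V) :=
  moduleOfAction _ (action C a₀ b₀)

theorem val_of_smul (g : G) (x : Corner C a₀ b₀ V) :
    val C a₀ b₀ (of ℤ G g • x) = elt C a₀ (g * (C b₀ a₀)⁻¹) b₀ • val C a₀ b₀ x :=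
  congrArg (val C a₀ b₀) (moduleOfAction_of_smul (action C a₀ b₀) g x)

theorem of_smul_mulElt (g h : G) (b : B) (x : V) :
    of ℤ G g • mulElt C a₀ b₀ h b x = mulElt C a₀ b₀ (g * h) b x :=
  val_injective C a₀ b₀ <| by
    rw [val_of_smul, val_mulElt, val_mulElt, elt_smul_elt_smul, inv_mul_cancel_right]

theorem mulElt_elt_smul (h g : G) (b b' : B) (a : A) (x : V) :
    mulElt C a₀ b₀ h b (elt C a g b' • x) = mulElt C a₀ b₀ (h * C b a * g) b' x :=
  val_injective C a₀ b₀ <| by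
    rw [val_mulElt, val_mulElt, elt_smul_elt_smul]

theorem mulElt_val (x : Corner C a₀ b₀ V) :
    mulElt C a₀ b₀ (C b₀ a₀)⁻¹ b₀ (val C a₀ b₀ x) = x :=
  val_injective C a₀ b₀ <| by rw [val_mulElt, elt_smul_val]

/-- Functoriality of the corner. -/
noncomputable def map (f : V →ₗ[MonoidRing C] W) :
    Corner C a₀ b₀ V →ₗ[MonoidAlgebra ℤ G] Corner C a₀ b₀ W :=
  linearOfEquivariant (codRestrict C a₀ b₀ (f.toAddMonoidHom.comp (val C a₀ b₀)) fun x => by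
    simp [← map_smul, elt_smul_val]) fun g x => val_injective C a₀ b₀ <| by
    rw [val_of_smul]
    change f (val C a₀ b₀ (of ℤ G g • x)) = elt C a₀ (g * (C b₀ a₀)⁻¹) b₀ • f (val C a₀ b₀ x)
    rw [val_of_smul, map_smul]

@[simp]
theorem val_map (f : V →ₗ[MonoidRing C] W) (x : Corner C a₀ b₀ V) :
    val C a₀ b₀ (map C a₀ b₀ f x) = f (val C a₀ b₀ x) := rfl

theorem map_mulElt (f : V →ₗ[MonoidRing C] W) (g : G) (b : B) (x : V) :
    map C a₀ b₀ f (mulElt C a₀ b₀ g b x) = mulElt C a₀ b₀ g b (f x) :=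
  val_injective C a₀ b₀ <| by rw [val_map, val_mulElt, val_mulElt, map_smul]

theorem map_injective {f : V →ₗ[MonoidRing C] W} (hf : Injective f) :
    Injective (map C a₀ b₀ f) := fun _ _ h =>
  val_injective C a₀ b₀ (hf (congrArg (val C a₀ b₀) h))

theorem map_surjective {f : V →ₗ[MonoidRing C] W} (hf : Surjective f) :
    Surjective (map C a₀ b₀ f) := fun y => by
  obtain ⟨x, hx⟩ := hf (val C a₀ b₀ y)
  exact ⟨mulElt C a₀ b₀ (C b₀ a₀)⁻¹ b₀ x, by rw [map_mulElt, hx, mulElt_val]⟩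

theorem map_exact {U : Type*} [AddCommGroup U] [Module (MonoidRing C) U]
    {i : U →ₗ[MonoidRing C] V} {p : V →ₗ[MonoidRing C] W} (h : Exact i p) :
    Exact (map C a₀ b₀ i) (map C a₀ b₀ p) := by
  intro x
  constructor
  · intro hx
    obtain ⟨y, hy⟩ := (h (val C a₀ b₀ x)).1 (by rw [← val_map, hx, map_zero])
    exact ⟨mulElt C a₀ b₀ (C b₀ a₀)⁻¹ b₀ y, by rw [map_mulElt, hy, mulElt_val]⟩
  · rintro ⟨y, rfl⟩
    exact val_injective C a₀ b₀ (by simp [h.apply_apply_eq_zero])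

/-- If `t` generates `V`, the elements `(a₀, 1, b) • v` with `v ∈ t` and `b ∈ B` generate the
corner; this is where finiteness of `B` enters. -/
theorem finite [Finite B] [Module.Finite (MonoidRing C) V] :
    Module.Finite (MonoidAlgebra ℤ G) (Corner C a₀ b₀ V) := by
  obtain ⟨t, ht⟩ := Module.Finite.fg_top (R := MonoidRing C) (M := V)
  set s : Set (Corner C a₀ b₀ V) :=
    Set.range fun z : B × t => mulElt C a₀ b₀ (1 : G) z.1 z.2.1
  set N := Submodule.span (MonoidAlgebra ℤ G) s
  refine ⟨Submodule.fg_def.2 ⟨s, Set.finite_range _, eq_top_iff.2 fun x _ => ?_⟩⟩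
  -- The induction needs all `b` at once, since acting by `(a, g, b')` replaces the index `b` by
  -- `b'`.
  have key : ∀ v : V, ∀ b, mulElt C a₀ b₀ 1 b v ∈ N := fun v => by
    have hv : v ∈ Submodule.span (MonoidRing C) (t : Set V) := ht ▸ Submodule.mem_top
    induction hv using Submodule.span_induction with
    | mem v hv => exact fun b => Submodule.subset_span ⟨(b, ⟨v, hv⟩), rfl⟩
    | zero => intro b; rw [map_zero]; exact N.zero_mem
    | add v w _ _ hv hw => intro b; rw [map_add]; exact N.add_mem (hv b) (hw b)
    | smul r v _ hv =>
      intro b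
      refine map_mem_of_forall_elt C N.toAddSubgroup ((mulElt C a₀ b₀ 1 b).comp
        (LinearMap.toSpanSingleton (MonoidRing C) V v).toAddMonoidHom) ?_ (fun a g b' => ?_) r
      · change mulElt C a₀ b₀ 1 b ((1 : MonoidRing C) • v) ∈ N
        rw [one_smul]
        exact hv b
      · change mulElt C a₀ b₀ 1 b (elt C a g b' • v) ∈ N
        have := N.smul_mem (of ℤ G (1 * C b a * g)) (hv b')
        rwa [of_smul_mulElt, mul_one, ← mulElt_elt_smul] at this
  have := N.smul_mem (of ℤ G (C b₀ a₀)⁻¹) (key (val C a₀ b₀ x) b₀)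
  rwa [of_smul_mulElt, mul_one, mulElt_val] at this

/-- The coinduced module is right adjoint to the corner. -/
noncomputable def toCoinduced {X : Type*} [AddCommGroup X] [Module (MonoidAlgebra ℤ G) X]
    (f : Corner C a₀ b₀ V →ₗ[MonoidAlgebra ℤ G] X) : V →ₗ[MonoidRing C] Coinduced C X :=
  linearOfElt C
    { toFun := fun v b => f (mulElt C a₀ b₀ 1 b v)
      map_zero' := funext fun _ => by simp; rfl
      map_add' := fun _ _ => funext fun _ => by simp; rfl } fun a g b v => funext fun b' => by
    change f (mulElt C a₀ b₀ 1 b' (elt C a g b • v)) = _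
    rw [Coinduced.elt_smul_apply, mulElt_elt_smul, one_mul]
    change _ = of ℤ G _ • f (mulElt C a₀ b₀ 1 b v)
    rw [← map_smul, of_smul_mulElt, mul_one]

/-- A left adjoint of a functor preserving surjections preserves projectives: a lifting problem out
of the corner becomes one out of `P` into coinduced modules. -/
theorem projective {P : Type (max u v w)} [AddCommGroup P] [Module (MonoidRing C) P]
    [Module.Projective (MonoidRing C) P] :
    Module.Projective (MonoidAlgebra ℤ G) (Corner C a₀ b₀ P) := by
  have : Small.{max u v w} (MonoidAlgebra ℤ G) := small_max.{max v w} _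
  refine Module.Projective.of_lifting_property fun {X Y} _ _ _ _ q f hq => ?_
  obtain ⟨l, hl⟩ := Module.projective_lifting_property (Coinduced.map C q)
    (toCoinduced C a₀ b₀ f) (Coinduced.map_surjective C hq)
  have hl' : ∀ v b, q (l v b) = f (mulElt C a₀ b₀ 1 b v) := fun v b =>
    congrFun (LinearMap.congr_fun hl v) b
  -- Going back through the adjunction is evaluation at `b₀`; the factor `C_{b₀a₀}⁻¹` turns `(a₀, 1,
  -- b₀)` into the idempotent, which fixes the corner.
  refine ⟨linearOfEquivariant
    { toFun := fun x => of ℤ G (C b₀ a₀)⁻¹ • l (val C a₀ b₀ x) b₀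
      map_zero' := by rw [map_zero, map_zero]; exact smul_zero _
      map_add' := fun _ _ => by rw [map_add, map_add]; exact smul_add _ _ _ } fun g x => ?_,
    LinearMap.ext fun x => ?_⟩
  · change of ℤ G (C b₀ a₀)⁻¹ • l (val C a₀ b₀ (of ℤ G g • x)) b₀ =
      of ℤ G g • of ℤ G (C b₀ a₀)⁻¹ • l (val C a₀ b₀ x) b₀
    rw [val_of_smul, map_smul, Coinduced.elt_smul_apply, smul_smul, smul_smul, ← map_mul,
      ← map_mul, inv_mul_cancel_left]
  · change q (of ℤ G (C b₀ a₀)⁻¹ • l (val C a₀ b₀ x) b₀) = f x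
    rw [map_smul, hl', ← map_smul, of_smul_mulElt, mul_one, mulElt_val]

theorem isFP [Finite B] {n : ℕ} {P : Type (max u v w)} [AddCommGroup P] [Module (MonoidRing C) P]
    (h : IsFP (MonoidRing C) n P) : IsFP (MonoidAlgebra ℤ G) n (Corner C a₀ b₀ P) := by
  induction n generalizing P with
  | zero =>
    have : Module.Finite (MonoidRing C) P := h
    exact finite C a₀ b₀
  | succ n ih =>
    obtain ⟨Q, K, _, _, _, _, i, p, _, _, hi, hip, hp, hK⟩ := h
    exact ⟨Corner C a₀ b₀ Q, Corner C a₀ b₀ K, inferInstance, inferInstance, inferInstance,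
      inferInstance, map C a₀ b₀ i, map C a₀ b₀ p, projective C a₀ b₀, finite C a₀ b₀,
      map_injective C a₀ b₀ hi, map_exact C a₀ b₀ hip, map_surjective C a₀ b₀ hp, ih hK⟩

end Corner

/-! ### Induction preserves projectivity and type `FP_n` -/

namespace Induced

theorem projective [Nonempty A] [Nonempty B] {P : Type z} [AddCommGroup P]
    [Small.{max v z} (MonoidRing C)]
    [Module (MonoidAlgebra ℤ G) P] [Module.Projective (MonoidAlgebra ℤ G) P] :
    Module.Projective (MonoidRing C) (Induced C P) := by
  obtain ⟨a₀⟩ := ‹Nonempty A›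
  obtain ⟨b₀⟩ := ‹Nonempty B›
  refine Module.Projective.of_lifting_property fun {X Y} _ _ _ _ q f hq => ?_
  -- The adjunct of `f`: its restriction to the summand `a₀`, which the idempotent fixes pointwise.
  -- The lift is found over `ℤG` and then spread to the summand `a` by `(a, C_{b₀a₀}⁻¹, b₀)`.
  let f₀ : P →ₗ[MonoidAlgebra ℤ G] Corner C a₀ b₀ Y := linearOfEquivariant
    (Corner.codRestrict C a₀ b₀ (f.toAddMonoidHom.comp (ι C a₀)) fun x => by
      simp [← map_smul, elt_smul_ι, -of_apply]) fun g x => Corner.val_injective C a₀ b₀ <| by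
      rw [Corner.val_of_smul]
      change f (ι C a₀ (of ℤ G g • x)) = elt C a₀ (g * (C b₀ a₀)⁻¹) b₀ • f (ι C a₀ x)
      rw [← map_smul, elt_smul_ι, inv_mul_cancel_right]
  obtain ⟨l, hl⟩ := Module.projective_lifting_property (Corner.map C a₀ b₀ q) f₀
    (Corner.map_surjective C a₀ b₀ hq)
  have hl' : ∀ x, q (Corner.val C a₀ b₀ (l x)) = f (ι C a₀ x) := fun x =>
    congrArg (Corner.val C a₀ b₀) (LinearMap.congr_fun hl x)
  refine ⟨linearLift C (fun a => (DistribSMul.toAddMonoidHom X (elt C a (C b₀ a₀)⁻¹ b₀)).comp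
    ((Corner.val C a₀ b₀).comp l.toAddMonoidHom)) fun a g b a' x => ?_,
    linearMap_ext C fun a x => ?_⟩
  · change elt C a (C b₀ a₀)⁻¹ b₀ • Corner.val C a₀ b₀ (l (of ℤ G (g * C b a') • x)) =
      elt C a g b • elt C a' (C b₀ a₀)⁻¹ b₀ • Corner.val C a₀ b₀ (l x)
    rw [map_smul, Corner.val_of_smul, elt_smul_elt_smul, elt_smul_elt_smul, inv_mul_cancel,
      one_mul]
  · rw [LinearMap.comp_apply, linearLift_ι]
    change q (elt C a (C b₀ a₀)⁻¹ b₀ • Corner.val C a₀ b₀ (l x)) = _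
    rw [map_smul, hl', ← map_smul, elt_smul_ι, inv_mul_cancel, map_one, one_smul]

theorem isFP [Nonempty A] [Nonempty B] {n : ℕ} {P : Type (max u v w)} [AddCommGroup P]
    [Module (MonoidAlgebra ℤ G) P] (h : IsFP (MonoidAlgebra ℤ G) n P) :
    IsFP (MonoidRing C) n (Induced C P) := by
  induction n generalizing P with
  | zero =>
    have : Module.Finite (MonoidAlgebra ℤ G) P := h
    exact finite C
  | succ n ih =>
    obtain ⟨Q, K, _, _, _, _, i, p, _, _, hi, hip, hp, hK⟩ := h
    exact ⟨Induced C Q, Induced C K, inferInstance, inferInstance, inferInstance,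
      inferInstance, map C i, map C p, projective C, finite C,
      map_injective C hi, map_exact C hip, map_surjective C hp, ih hK⟩

end Induced

end

end ReesMatrixSemigroup

/-! ### Additive maps out of the monoid ring -/

namespace MonoidAlgebra

theorem addHom_ext_of {M : Type u} [Monoid M] {X : Type v} [AddCommGroup X]
    {f g : MonoidAlgebra ℤ M →+ X} (h : ∀ m, f (of ℤ M m) = g (of ℤ M m)) : f = g :=
  AddMonoidHom.ext fun r => sub_eq_zero.1 <|
    (AddSubgroup.mem_bot (G := X)).1 (map_mem_of_forall_of ⊥ (f - g)
      (fun m => AddSubgroup.mem_bot.2 (sub_eq_zero.2 (h m))) r)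

/-- The additive map from the integral monoid ring with given values on the monoid. -/
noncomputable def addLift {M : Type u} [Monoid M] {X : Type v} [AddCommGroup X] (f : M → X) :
    MonoidAlgebra ℤ M →+ X :=
  (Finsupp.liftAddHom fun m => zmultiplesHom X (f m)).comp coeffAddEquiv.toAddMonoidHom

theorem addLift_of {M : Type u} [Monoid M] {X : Type v} [AddCommGroup X] (f : M → X) (m : M) :
    addLift f (of ℤ M m) = f m := by
  change Finsupp.liftAddHom (fun m => zmultiplesHom X (f m)) (Finsupp.single m (1 : ℤ)) = f m
  rw [Finsupp.liftAddHom_apply_single]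
  exact one_zsmul _

end MonoidAlgebra

namespace IsFP

theorem of_projective {R : Type u} [Ring R] {n : ℕ} (V : Type v) [AddCommGroup V] [Module R V]
    [Module.Projective R V] [Module.Finite R V] : IsFP R n V := by
  cases n with
  | zero => exact ‹Module.Finite R V›
  | succ n =>
    refine ⟨V, (⊥ : Submodule R V), inferInstance, inferInstance, inferInstance, inferInstance,
      (⊥ : Submodule R V).subtype, LinearMap.id, inferInstance, inferInstance,
      Submodule.subtype_injective _, fun x => ?_, surjective_id, of_subsingleton _⟩
    simp

end IsFP

/-- The integers with trivial action of the monoid `M`. -/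
def TrivialModule (_ : Type u) : Type z := ULift.{z} ℤ

namespace TrivialModule

open MonoidAlgebra

instance (M : Type u) : AddCommGroup (TrivialModule.{u, z} M) :=
  inferInstanceAs (AddCommGroup (ULift ℤ))

/-- The identification with the integers. -/
def toInt (M : Type u) : TrivialModule.{u, z} M ≃+ ℤ := AddEquiv.ulift

variable {M : Type u} [Monoid M]

noncomputable instance : Module (MonoidAlgebra ℤ M) (TrivialModule.{u, z} M) :=
  moduleOfAction _ 1

theorem of_smul (m : M) (x : TrivialModule.{u, z} M) : of ℤ M m • x = x :=
  moduleOfAction_of_smul 1 m x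

/-- Modules with trivial action and underlying group `ℤ` are isomorphic to the trivial module. -/
noncomputable def linearEquiv {V : Type v} [AddCommGroup V] [Module (MonoidAlgebra ℤ M) V]
    (e : V ≃+ ℤ) (h : ∀ m (v : V), of ℤ M m • v = v) :
    V ≃ₗ[MonoidAlgebra ℤ M] TrivialModule.{u, z} M :=
  LinearEquiv.ofBijective
    (linearOfEquivariant (e.trans (toInt M).symm).toAddMonoidHom fun m v => by rw [h, of_smul])
    (e.trans (toInt M).symm).bijective

end TrivialModule

-- The free universe parameter lets the trivial module of `G` be placed in the universe where
-- induction to `M` and the corner functor operate.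
open MonoidAlgebra in
theorem monoidIsOfTypeFP_iff_isFP {M : Type u} [Monoid M] {n : ℕ} :
    MonoidIsOfTypeFP M n ↔ IsFP (MonoidAlgebra ℤ M) n (TrivialModule.{u, max u z} M) := by
  have e : (Representation.trivial ℤ M ℤ).asModule ≃ₗ[MonoidAlgebra ℤ M] TrivialModule.{u, u} M :=
    TrivialModule.linearEquiv (Representation.trivial ℤ M ℤ).asModuleEquiv.toAddEquiv fun m v =>
      ((Representation.trivial ℤ M ℤ).asModuleEquiv_symm_map_rho m
        ((Representation.trivial ℤ M ℤ).asModuleEquiv v)).symm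
  refine (moduleIsOfTypeFP_iff_of_linearEquiv e).trans (moduleIsOfTypeFP_iff_isFP.trans ⟨?_, ?_⟩)
  · exact IsFP.of_linearEquiv (TrivialModule.linearEquiv (TrivialModule.toInt M)
      TrivialModule.of_smul)
  · exact IsFP.of_linearEquiv.{u, max u z, u} (TrivialModule.linearEquiv (TrivialModule.toInt M)
      TrivialModule.of_smul)

namespace ReesMatrixSemigroup

open MonoidAlgebra

section

variable {G : Type u} {A : Type v} {B : Type w} [Group G] (C : Matrix B A G)

/-! ### The integers with the semigroup acting by zero -/

/-- The integers, on which the adjoined identity acts as the identity and the semigroup as zero. -/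
def ZeroModule (_ : Matrix B A G) : Type (max u v w) := ULift.{max u v w} ℤ

namespace ZeroModule

instance : AddCommGroup (ZeroModule C) := inferInstanceAs (AddCommGroup (ULift ℤ))

/-- The identification with the integers. -/
def toInt : ZeroModule C ≃+ ℤ := AddEquiv.ulift

/-- The zero action of the semigroup. -/
def action (_ : A) (_ : G) (_ : B) : AddMonoid.End (ZeroModule C) := 0

theorem action_mul (a : A) (g : G) (b : B) (a' : A) (g' : G) (b' : B) :
    action C a (g * C b a' * g') b' = action C a g b * action C a' g' b' := (zero_mul _).symm

noncomputable instance : Module (MonoidRing C) (ZeroModule C) :=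
  moduleOfSemigroupAction _ (action C) (action_mul C)

theorem elt_smul (a : A) (g : G) (b : B) (x : ZeroModule C) : elt C a g b • x = 0 :=
  moduleOfSemigroupAction_elt_smul C (action C) (action_mul C) a g b x

/-- The projection of the monoid ring with kernel the semigroup ring. -/
noncomputable def proj : MonoidRing C →ₗ[MonoidRing C] ZeroModule C :=
  LinearMap.toSpanSingleton _ _ ((toInt C).symm 1)

theorem proj_one : proj C 1 = (toInt C).symm 1 := one_smul _ _

theorem proj_elt (a : A) (g : G) (b : B) : proj C (elt C a g b) = 0 := elt_smul C a g b _

theorem proj_surjective : Surjective (proj C) := fun x =>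
  ⟨(toInt C x : ℤ) • (1 : MonoidRing C), by
    rw [map_zsmul, proj_one, ← map_zsmul, smul_eq_mul, mul_one, AddEquiv.symm_apply_apply]⟩

/-- The inclusion of a column of the semigroup ring into the monoid ring. -/
noncomputable def inclColumn (a : A) : (B →₀ MonoidAlgebra ℤ G) →+ MonoidRing C :=
  Finsupp.liftAddHom fun b => addLift fun g => elt C a g b

theorem inclColumn_single (a : A) (b : B) (g : G) :
    inclColumn C a (Finsupp.single b (of ℤ G g)) = elt C a g b := by
  rw [inclColumn, Finsupp.liftAddHom_apply_single, addLift_of]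

theorem hom_ext {X : Type*} [AddCommGroup X] {f g : (B →₀ MonoidAlgebra ℤ G) →+ X}
    (h : ∀ b x, f (Finsupp.single b (of ℤ G x)) = g (Finsupp.single b (of ℤ G x))) : f = g :=
  Finsupp.addHom_ext' fun b => addHom_ext_of fun x => h b x

/-- The inclusion of the semigroup ring into the monoid ring. -/
noncomputable def incl : Induced C (B →₀ MonoidAlgebra ℤ G) →ₗ[MonoidRing C] MonoidRing C :=
  Induced.linearLift C (inclColumn C) fun a g b a' x => by
    refine DFunLike.congr_fun
      (f := (inclColumn C a).comp (DistribSMul.toAddMonoidHom _ (of ℤ G (g * C b a'))))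
      (g := (DistribSMul.toAddMonoidHom _ (elt C a g b)).comp (inclColumn C a'))
      (hom_ext fun b' g' => ?_) x
    simp only [AddMonoidHom.comp_apply, DistribSMul.toAddMonoidHom_apply, Finsupp.smul_single,
      smul_eq_mul, ← map_mul, inclColumn_single, elt_mul_elt]

theorem incl_ι_single (a : A) (b : B) (g : G) :
    incl C (Induced.ι C a (Finsupp.single b (of ℤ G g))) = elt C a g b :=
  (Induced.linearLift_ι C (inclColumn C) _ a _).trans (inclColumn_single C a b g)

/-- The projection of the monoid ring to the semigroup ring, as an additive map. -/
noncomputable def retraction : MonoidRing C →+ Induced C (B →₀ MonoidAlgebra ℤ G) :=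
  addLift fun m => Option.elim (show Option (ReesMatrixSemigroup C) from m) 0 fun s =>
    Induced.ι C s.fstIdx (Finsupp.single s.sndIdx (of ℤ G s.val))

theorem retraction_one : retraction C 1 = 0 := by
  rw [← map_one (of ℤ _), retraction, addLift_of]
  rfl

theorem retraction_elt (a : A) (b : B) (g : G) :
    retraction C (elt C a g b) = Induced.ι C a (Finsupp.single b (of ℤ G g)) := by
  rw [elt, retraction, addLift_of]
  rfl

theorem retraction_incl (x : Induced C (B →₀ MonoidAlgebra ℤ G)) :
    retraction C (incl C x) = x := by
  refine DFunLike.congr_fun (f := (retraction C).comp (incl C).toAddMonoidHom)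
    (g := AddMonoidHom.id _) (Induced.hom_ext C fun a v => ?_) x
  refine DFunLike.congr_fun
    (f := ((retraction C).comp (incl C).toAddMonoidHom).comp (Induced.ι C a)) (g := Induced.ι C a) (hom_ext fun b g => ?_) v
  change retraction C (incl C _) = _
  rw [incl_ι_single, retraction_elt]

/-- The additive splitting `ℤM = ℤS ⊕ ℤ·1`, from which exactness of `ℤS → ℤM → ℤM/ℤS` is read off.
-/
theorem incl_retraction_add (r : MonoidRing C) :
    incl C (retraction C r) + toInt C (proj C r) • 1 = r := by
  have := map_mem_of_forall_elt C (⊥ : AddSubgroup (MonoidRing C))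
    ((incl C).toAddMonoidHom.comp (retraction C) + ((zmultiplesHom _ 1).comp
      (toInt C).toAddMonoidHom).comp (proj C).toAddMonoidHom - AddMonoidHom.id _) ?_ ?_ r
  · exact sub_eq_zero.1 this
  · change incl C (retraction C 1) + toInt C (proj C 1) • 1 - 1 = 0
    rw [retraction_one, map_zero, proj_one, AddEquiv.apply_symm_apply, one_smul, zero_add, sub_self]
  · intro a g b
    change incl C (retraction C (elt C a g b)) + toInt C (proj C (elt C a g b)) • 1 -
      elt C a g b = 0
    rw [retraction_elt, incl_ι_single, proj_elt, map_zero, zero_smul, add_zero, sub_self]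

theorem exact_incl_proj : Exact (incl C) (proj C) := by
  intro r
  constructor
  · intro h
    have := incl_retraction_add C r
    rw [h, map_zero, zero_smul, add_zero] at this
    exact ⟨_, this⟩
  · rintro ⟨x, rfl⟩
    have := incl_retraction_add C (incl C x)
    rw [retraction_incl, add_eq_left] at this
    have h := congrArg (proj C) this
    rwa [map_zsmul, proj_one, ← map_zsmul, smul_eq_mul, mul_one, AddEquiv.symm_apply_apply,
      map_zero] at h

/-- `ℤS → ℤM` is a resolution of length one by finitely generated projectives: `ℤS` is induced from
a free `ℤG`-module of rank `|B|`, which is finite. -/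
theorem isFP [Nonempty A] [Nonempty B] [Finite B] (n : ℕ) :
    IsFP (MonoidRing C) n (ZeroModule C) := by
  cases n with
  | zero => exact Module.Finite.of_surjective _ (proj_surjective C)
  | succ n =>
    have := Induced.finite C (V := B →₀ MonoidAlgebra ℤ G)
    have := Induced.projective C (P := B →₀ MonoidAlgebra ℤ G)
    refine ⟨MonoidRing C, Induced C (B →₀ MonoidAlgebra ℤ G), inferInstance, inferInstance,
      inferInstance, inferInstance, incl C, proj C, inferInstance, inferInstance,
      (LeftInverse.injective (retraction_incl C)), exact_incl_proj C, proj_surjective C,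
      IsFP.of_projective _⟩

end ZeroModule

end

end ReesMatrixSemigroup

namespace TrivialModule

instance finite (M : Type u) [Monoid M] :
    Module.Finite (MonoidAlgebra ℤ M) (TrivialModule.{u, v} M) :=
  Module.Finite.of_surjective
    (LinearMap.toSpanSingleton (MonoidAlgebra ℤ M) (TrivialModule.{u, v} M) ((toInt M).symm 1))
    fun x => ⟨(toInt M x : ℤ) • (1 : MonoidAlgebra ℤ M), by
      rw [map_zsmul, LinearMap.toSpanSingleton_apply, one_smul, ← map_zsmul, smul_eq_mul,
        mul_one, AddEquiv.symm_apply_apply]⟩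

end TrivialModule

/-! ### The permutation module on `A` and the two implications -/

namespace ReesMatrixSemigroup

open MonoidAlgebra

section

variable {G : Type u} {A : Type v} {B : Type w} [Group G] (C : Matrix B A G)

/-- The integers with trivial action of the monoid. -/
abbrev Triv : Type (max u v w) := TrivialModule.{max u v w, max u v w} (WithOne (ReesMatrixSemigroup C))

/-- The permutation module on `A`: the module induced from the trivial module of the group. -/
abbrev PermModule : Type (max u v w) := Induced C (TrivialModule.{u, max u v w} G)

namespace PermModule

/-- The generator with index `a`. -/
noncomputable def gen (a : A) : PermModule C :=
  Induced.ι C a ((TrivialModule.toInt G).symm 1)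

/-- The coefficient with index `a`. -/
noncomputable def coeff (a : A) : PermModule C →+ ℤ :=
  (TrivialModule.toInt G).toAddMonoidHom.comp (Finsupp.applyAddHom a)

theorem coeff_gen_self (a : A) : coeff C a (gen C a) = 1 := by
  change TrivialModule.toInt G ((Finsupp.single a _ : A →₀ TrivialModule.{u, max u v w} G) a) = 1
  rw [Finsupp.single_eq_same, AddEquiv.apply_symm_apply]

theorem coeff_gen_of_ne {a a' : A} (h : a ≠ a') : coeff C a (gen C a') = 0 := by
  change TrivialModule.toInt G ((Finsupp.single a' _ : A →₀ TrivialModule.{u, max u v w} G) a) = 0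
  rw [Finsupp.single_eq_of_ne h, map_zero]

theorem ext {x y : PermModule C} (h : ∀ a, coeff C a x = coeff C a y) : x = y :=
  Finsupp.ext fun a => (TrivialModule.toInt G).injective (h a)

/-- The augmentation of the permutation module. -/
noncomputable def aug : PermModule C →ₗ[MonoidRing C] Triv C :=
  Induced.linearLift C (fun _ => ((TrivialModule.toInt G).trans
    (TrivialModule.toInt (WithOne (ReesMatrixSemigroup C))).symm).toAddMonoidHom)
    fun a g b a' x => by rw [TrivialModule.of_smul, elt, TrivialModule.of_smul]

theorem aug_ι (a : A) (x : TrivialModule.{u, max u v w} G) :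
    aug C (Induced.ι C a x) = (TrivialModule.toInt _).symm (TrivialModule.toInt G x) :=
  Induced.linearLift_ι C _ _ a x

theorem aug_gen (a : A) : aug C (gen C a) = (TrivialModule.toInt _).symm 1 := by
  rw [gen, aug_ι, AddEquiv.apply_symm_apply]

theorem aug_surjective [Nonempty A] : Surjective (aug C) := fun x => by
  obtain ⟨a⟩ := ‹Nonempty A›
  exact ⟨Induced.ι C a ((TrivialModule.toInt _).symm (TrivialModule.toInt _ x)), by
    rw [aug_ι, AddEquiv.apply_symm_apply, AddEquiv.symm_apply_apply]⟩

theorem elt_smul (a : A) (g : G) (b : B) (x : PermModule C) :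
    elt C a g b • x = Induced.ι C a
      ((TrivialModule.toInt G).symm (TrivialModule.toInt _ (aug C x))) := by
  refine DFunLike.congr_fun (f := DistribSMul.toAddMonoidHom _ (elt C a g b))
    (g := (((Induced.ι C a).comp (TrivialModule.toInt G).symm.toAddMonoidHom).comp
      (TrivialModule.toInt _).toAddMonoidHom).comp (aug C).toAddMonoidHom)
    (Induced.hom_ext C fun a' v => ?_) x
  change elt C a g b • Induced.ι C a' v = Induced.ι C a
      ((TrivialModule.toInt G).symm (TrivialModule.toInt _ (aug C (Induced.ι C a' v))))
  rw [Induced.elt_smul_ι, TrivialModule.of_smul, aug_ι, AddEquiv.apply_symm_apply,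
    AddEquiv.symm_apply_apply]

/-- Consequently `ℤM` acts on the augmentation kernel through `ℤ`, and submodules of the kernel are
just subgroups. -/
theorem elt_smul_eq_zero (a : A) (g : G) (b : B) {x : PermModule C} (hx : aug C x = 0) :
    elt C a g b • x = 0 := by
  rw [elt_smul, hx, map_zero, map_zero, map_zero]

/-- The augmentation kernel is finitely generated as an abelian group, so its elements are supported
in one finite set `U`; but every difference `gen a - gen a₀` lies in it. -/
theorem finite_index [Nonempty A] [Nonempty B] {n : ℕ} (h : IsFP (MonoidRing C) (n + 1) (Triv C)) :
    Finite A := by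
  classical
  have := h.finitePresentation
  have : Module.Finite (MonoidRing C) (PermModule C) := Induced.finite C
  obtain ⟨t, ht⟩ := Module.FinitePresentation.fg_ker (aug C) (aug_surjective C)
  set U : Finset A := t.biUnion fun x => Finsupp.support (show A →₀ TrivialModule G from x)
  have key : ∀ x : PermModule C, aug C x = 0 → ∀ a ∉ U, coeff C a x = 0 := fun x hx => by
    have hx' : x ∈ Submodule.span (MonoidRing C) (t : Set (PermModule C)) := ht ▸ hx
    clear hx
    induction hx' using Submodule.span_induction with
    | mem x hx =>
      intro a ha
      have : a ∉ Finsupp.support (show A →₀ TrivialModule G from x) := fun h =>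
        ha (Finset.mem_biUnion.2 ⟨x, hx, h⟩)
      exact (congrArg (TrivialModule.toInt G) (Finsupp.notMem_support_iff.1 this)).trans
        (map_zero _)
    | zero => intro a _; exact map_zero _
    | add x y _ _ hx hy => intro a ha; rw [map_add, hx a ha, hy a ha, add_zero]
    | smul r x hx h =>
      intro a ha
      rw [ht, LinearMap.mem_ker] at hx
      refine map_mem_of_forall_elt C (coeff C a).ker
        (LinearMap.toSpanSingleton (MonoidRing C) _ x).toAddMonoidHom ?_ (fun a' g b => ?_) r
      · change coeff C a ((1 : MonoidRing C) • x) = 0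
        rw [one_smul, h a ha]
      · change coeff C a (elt C a' g b • x) = 0
        rw [elt_smul_eq_zero C a' g b hx, map_zero]
  obtain ⟨a₀⟩ := ‹Nonempty A›
  refine Set.finite_univ_iff.1 ((insert a₀ U).finite_toSet.subset fun a _ => ?_)
  by_contra ha
  rw [Finset.mem_coe, Finset.mem_insert, not_or] at ha
  have := key (gen C a - gen C a₀) (by rw [map_sub, aug_gen, aug_gen, sub_self]) a ha.2
  rw [map_sub, coeff_gen_self, coeff_gen_of_ne C ha.1] at this
  simp at this

/-- The kernel embeds in `ℤ^A` with `A` finite, so it is free abelian of finite rank. Since `S` acts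
by zero on it, any `ℤ`-basis identifies it with a power of `ZeroModule C`. -/
theorem isFP_ker_aug [Nonempty A] [Nonempty B] [Finite A] [Finite B] (n : ℕ) :
    IsFP (MonoidRing C) n (LinearMap.ker (aug C)) := by
  let f : LinearMap.ker (aug C) →+ (A → ℤ) :=
    (AddMonoidHom.mk' (fun x a => coeff C a x) fun x y => funext fun a => map_add _ _ _).comp
      (LinearMap.ker (aug C)).subtype.toAddMonoidHom
  have hf : Injective f.toIntLinearMap := fun x y h => Subtype.ext (ext C (congrFun h))
  let b := Module.finBasis ℤ (LinearMap.range f.toIntLinearMap)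
  let e : LinearMap.ker (aug C) ≃+ (Fin (Module.finrank ℤ (LinearMap.range f.toIntLinearMap)) →
      ZeroModule C) := ((LinearEquiv.ofInjective _ hf).toAddEquiv.trans
        b.equivFun.toAddEquiv).trans (AddEquiv.arrowCongr (Equiv.refl _) (ZeroModule.toInt C).symm)
  have he : ∀ a g b x, e (elt C a g b • x) = elt C a g b • e x := fun a g b x => by
    have h1 : elt C a g b • x = 0 := Subtype.ext (elt_smul_eq_zero C a g b x.2)
    rw [h1, map_zero]
    exact funext fun i => (ZeroModule.elt_smul C a g b _).symm
  exact ((ZeroModule.isFP C n).pi_fin _).of_linearEquiv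
    (LinearEquiv.ofBijective (linearOfElt C e.toAddMonoidHom he) e.bijective).symm

theorem isFP_triv [Nonempty A] [Nonempty B] [Finite A] [Finite B] {n : ℕ}
    (h : IsFP (MonoidAlgebra ℤ G) (n + 1) (TrivialModule.{u, max u v w} G)) :
    IsFP (MonoidRing C) (n + 1) (Triv C) :=
  IsFP.quotient (LinearMap.ker (aug C)).subtype (aug C) (Submodule.subtype_injective _)
    (LinearMap.exact_subtype_ker_map _) (aug_surjective C) (isFP_ker_aug C n) (Induced.isFP C h)

end PermModule

/-- The idempotent acts as the identity on the trivial module, so its corner is all of `ℤ`, with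
trivial action of `G`. -/
theorem isFP_trivialModule_group [Nonempty A] [Nonempty B] [Finite B] {n : ℕ}
    (h : IsFP (MonoidRing C) n (Triv C)) :
    IsFP (MonoidAlgebra ℤ G) n (TrivialModule.{u, max u v w} G) := by
  obtain ⟨a₀⟩ := ‹Nonempty A›
  obtain ⟨b₀⟩ := ‹Nonempty B›
  let e : Corner C a₀ b₀ (Triv C) ≃+ ℤ := (AddEquiv.ofBijective (Corner.val C a₀ b₀)
    ⟨Corner.val_injective C a₀ b₀, fun x => ⟨Corner.mulElt C a₀ b₀ (C b₀ a₀)⁻¹ b₀ x, by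
      rw [Corner.val_mulElt, elt, TrivialModule.of_smul]⟩⟩).trans (TrivialModule.toInt _)
  refine IsFP.of_linearEquiv.{u, max u v w, max v w}
    (TrivialModule.linearEquiv.{_, _, max u v w} e fun g x => ?_) (Corner.isFP C a₀ b₀ h)
  refine Corner.val_injective C a₀ b₀ ?_
  rw [Corner.val_of_smul, elt, TrivialModule.of_smul]

end

end ReesMatrixSemigroup

theorem mainTheorem8 {G : Type u} [Group G] {A : Type v} {B : Type w} [Nonempty A] [Nonempty B]
    [Finite B] (C : Matrix B A G) (n : ℕ) (hn : 1 ≤ n) :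
    MonoidIsOfTypeFP (WithOne (ReesMatrixSemigroup C)) n ↔ Finite A ∧ MonoidIsOfTypeFP G n := by
  -- Degree at least one is essential: `ℤ` is cyclic over `ℤM`, so `FP_0` says nothing about `A`.
  obtain ⟨n, rfl⟩ := Nat.exists_eq_add_of_le' hn
  rw [monoidIsOfTypeFP_iff_isFP.{max u v w, max u v w}, monoidIsOfTypeFP_iff_isFP.{u, max v w}]
  constructor
  · intro h
    exact ⟨ReesMatrixSemigroup.PermModule.finite_index C h,
      ReesMatrixSemigroup.isFP_trivialModule_group C h⟩
  · rintro ⟨_, h⟩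
    exact ReesMatrixSemigroup.PermModule.isFP_triv C h
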